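/- \textbf{Theorem.} Let $n\ge 3$ and let $x_1<\dots<x_n$ be real numbers. Let $$K=\mathcal K^C_{x_1,\dots,x_n}=\Big\{u\in\mathbb R^n:\ \frac{u_i-u_{i-1}}{x_i-x_{i-1}}\le\frac{u_{i+1}-u_i}{x_{i+1}-x_i},\quad i=2,\dots,n-1\Big\}$$ be the closed convex cone of convex sequences over the design points $x_1,\dots,x_n$, let $\Pi_K(y)$ denote the Euclidean projection of $y\in\mathbb R^n$ onto $K$ (the unique point of $K$ nearest to $y$), and let $g\sim\mathcal N(0,I_{n\times n})$ be a standard Gaussian vector in $\mathbb R^n$. Then $\|\Pi_K(g)\|_2^2$ is integrable, and the statistical dimension $\delta(K)=\mathbb E\big[\|\Pi_K(g)\|_2^2\big]$ of $K$ satisfies $$\delta(K)=\mathbb E\big[\|\Pi_K(g)\|_2^2\big]\le 8\log(en).$$ -/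

import Mathlib

open MeasureTheory ProbabilityTheory

/-- Every point of a Euclidean space has a unique nearest point in a given closed convex cone.
(Such a cone, being a `ProperCone`, contains `0`.) -/
theorem existsUnique_nearest_point {E : Type*} [NormedAddCommGroup E] [InnerProductSpace ℝ E]
    [FiniteDimensional ℝ E] (K : ProperCone ℝ E) (y : E) :
    ∃! p : E, p ∈ K ∧ ∀ q ∈ K, ‖y - p‖ ≤ ‖y - q‖ := by
  have hne : (K : Set E).Nonempty := ⟨0, K.zero_mem⟩
  have hcl : IsClosed (K : Set E) := K.isClosed
  have hconv : Convex ℝ (K : Set E) := by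
    intro a ha b hb s t hs ht _
    exact K.add_mem (K.smul_mem ha hs)
      (K.smul_mem hb ht)
  obtain ⟨p, hp, hdist⟩ := hcl.exists_infDist_eq_dist hne y
  have hmin : ∀ q ∈ K, ‖y - p‖ ≤ ‖y - q‖ := by
    intro q hq
    rw [← dist_eq_norm, ← dist_eq_norm, ← hdist]
    exact Metric.infDist_le_dist_of_mem hq
  refine ⟨p, ⟨hp, hmin⟩, ?_⟩
  rintro r ⟨hr, hrmin⟩
  have heq : ‖y - r‖ = ‖y - p‖ := le_antisymm (hrmin p hp) (hmin r hr)
  have hmid : (1 / 2 : ℝ) • r + (1 / 2 : ℝ) • p ∈ K :=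
    hconv hr hp (by norm_num) (by norm_num) (by norm_num)
  have h1 := hmin _ hmid
  have h2 := parallelogram_law_with_norm ℝ (y - r) (y - p)
  have h3 : (y - r) + (y - p) = (2 : ℝ) • (y - ((1 / 2 : ℝ) • r + (1 / 2 : ℝ) • p)) := by
    module
  have h4 : (y - r) - (y - p) = p - r := by abel
  rw [h3, h4, norm_smul, heq] at h2
  norm_num at h2
  have h5 : ‖p - r‖ = 0 := by nlinarith [norm_nonneg (p - r), norm_nonneg (y - p)]
  exact (sub_eq_zero.mp (norm_eq_zero.mp h5)).symm

/-- The Euclidean projection `Π_K(y)` of `y` onto the closed convex cone `K`: the point of `K`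
nearest to `y`. -/
noncomputable def coneProj {E : Type*} [NormedAddCommGroup E] [InnerProductSpace ℝ E]
    [FiniteDimensional ℝ E] (K : ProperCone ℝ E) (y : E) : E :=
  Classical.choose (existsUnique_nearest_point K y).exists

theorem coneProj_spec {E : Type*} [NormedAddCommGroup E] [InnerProductSpace ℝ E]
    [FiniteDimensional ℝ E] (K : ProperCone ℝ E) (y : E) :
    coneProj K y ∈ K ∧ ∀ q ∈ K, ‖y - coneProj K y‖ ≤ ‖y - q‖ :=
  Classical.choose_spec (existsUnique_nearest_point K y).exists

/-- The statistical dimension `δ(K) = 𝔼 ‖Π_K(g)‖²`, `g ∼ N(0, Iₙ)`, of a closed convex cone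
`K ⊆ ℝⁿ`. -/
noncomputable def statDim {n : ℕ} (K : ProperCone ℝ (EuclideanSpace ℝ (Fin n))) : ℝ :=
  ∫ g, ‖coneProj K g‖ ^ 2 ∂(stdGaussian (EuclideanSpace ℝ (Fin n)))

/-- The cone of convex sequences over the design points `x`: the vectors `u` whose successive
slopes `(u_{i+1} - u_i) / (x_{i+1} - x_i)` are nondecreasing. Indices start at `0`. -/
noncomputable def convexSeqCone {n : ℕ} (x : Fin n → ℝ) :
    ProperCone ℝ (EuclideanSpace ℝ (Fin n)) where
  carrier := {u | ∀ (i : ℕ) (hi : i + 2 < n),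
    (u ⟨i + 1, by omega⟩ - u ⟨i, by omega⟩) / (x ⟨i + 1, by omega⟩ - x ⟨i, by omega⟩) ≤
      (u ⟨i + 2, hi⟩ - u ⟨i + 1, by omega⟩) / (x ⟨i + 2, hi⟩ - x ⟨i + 1, by omega⟩)}
  zero_mem' := by
    intro i hi
    simp
  add_mem' := by
    intro u v hu hv i hi
    have h1 := hu i hi
    have h2 := hv i hi
    simp only [PiLp.add_apply, add_sub_add_comm, add_div]
    exact add_le_add h1 h2
  smul_mem' := by
    intro c u hu i hi
    have h1 := mul_le_mul_of_nonneg_left (hu i hi) c.2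
    have h2 : ∀ j, (c • u) j = (c : ℝ) * u j := fun j => rfl
    simp only [h2, ← mul_sub, mul_div_assoc]
    exact h1
  isClosed' := by
    have h : ∀ (i : ℕ) (hi : i + 2 < n), IsClosed {u : EuclideanSpace ℝ (Fin n) |
        (u ⟨i + 1, by omega⟩ - u ⟨i, by omega⟩) / (x ⟨i + 1, by omega⟩ - x ⟨i, by omega⟩) ≤
          (u ⟨i + 2, hi⟩ - u ⟨i + 1, by omega⟩) / (x ⟨i + 2, hi⟩ - x ⟨i + 1, by omega⟩)} :=
      fun i hi => isClosed_le (by fun_prop) (by fun_prop)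
    have h' := isClosed_iInter fun i => isClosed_iInter fun hi => h i hi
    convert h' using 1
    ext u
    simp only [Set.mem_iInter]
    rfl

/-! The bound comes from an exponential moment: `𝔼 exp (3/8 * ‖Π_K g‖²) ≤ (e n)³`, after which
Jensen's inequality gives `3/8 * δ(K) ≤ 3 log (e n)`.

A convex sequence decreases up to some index `m` and increases afterwards. Since `‖Π_K g‖² = 2⟨g, p⟩
- ‖p‖²` with `p = Π_K g`, cutting at `m` bounds `‖Π_K g‖²` by the squared norms of two isotonic
fits, of lengths `m` and `n - m`, on disjoint coordinates
(`exists_norm_coneProj_convexSeqCone_sq_le`). The index `m` is random, so one sums over all its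
values and uses independence.

It remains to show that the moment `M n` of the isotonic fit is at most `n + 1` (`fitMoment_le`).
Deleting a level block of length `k` leaves the isotonic fit of the remaining data, and the block
contributes `k * mean²`. Within the block the centred partial sums are nonnegative. By the cycle
lemma, almost surely at most one of the `k` cyclic shifts has this property, so the block costs at
most `(1/k) * 𝔼 exp (3/8 * Z²) = 2/k`, `Z` standard normal. Counting each block once per index in it
cancels the `1/k` and yields `n * M n ≤ 2 * ∑ r < n, M r` (`mul_fitMoment_le`). -/

open scoped ENNReal

/-! ### Variational inequalities for the projection onto a closed convex cone. -/

section ConeProjection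

variable {E : Type*} [NormedAddCommGroup E] [InnerProductSpace ℝ E] [FiniteDimensional ℝ E]

theorem inner_sub_coneProj_sub_nonpos (K : ProperCone ℝ E) (y : E) {q : E} (hq : q ∈ K) :
    inner ℝ (y - coneProj K y) (q - coneProj K y) ≤ 0 := by
  have hconv : Convex ℝ (K : Set E) := fun a ha b hb s t hs ht _ =>
    K.add_mem (K.smul_mem ha hs) (K.smul_mem hb ht)
  obtain ⟨hp, hmin⟩ := coneProj_spec K y
  refine (norm_eq_iInf_iff_real_inner_le_zero hconv hp).1 ?_ q hq
  have : Nonempty (K : Set E) := ⟨⟨0, K.zero_mem⟩⟩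
  refine le_antisymm (le_ciInf fun w => hmin w w.2) ?_
  exact ciInf_le ⟨0, by rintro _ ⟨w, rfl⟩; exact norm_nonneg _⟩ (⟨_, hp⟩ : (K : Set E))

theorem inner_sub_coneProj_self (K : ProperCone ℝ E) (y : E) :
    inner ℝ (y - coneProj K y) (coneProj K y) = 0 := by
  have hp := (coneProj_spec K y).1
  have h0 := inner_sub_coneProj_sub_nonpos K y K.zero_mem
  have h2 := inner_sub_coneProj_sub_nonpos K y (K.add_mem hp hp)
  simp only [zero_sub, inner_neg_right, add_sub_cancel_right] at h0 h2
  linarith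

theorem inner_sub_coneProj_nonpos (K : ProperCone ℝ E) (y : E) {q : E} (hq : q ∈ K) :
    inner ℝ (y - coneProj K y) q ≤ 0 := by
  have h := inner_sub_coneProj_sub_nonpos K y hq
  rwa [inner_sub_right, inner_sub_coneProj_self, sub_zero] at h

theorem norm_coneProj_sub_le (K : ProperCone ℝ E) (y z : E) :
    ‖coneProj K y - coneProj K z‖ ≤ ‖y - z‖ := by
  have h1 := inner_sub_coneProj_sub_nonpos K y (coneProj_spec K z).1
  have h2 := inner_sub_coneProj_sub_nonpos K z (coneProj_spec K y).1
  set p := coneProj K y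
  set q := coneProj K z
  have h3 : ‖p - q‖ ^ 2 ≤ inner ℝ (y - z) (p - q) := by
    rw [← real_inner_self_eq_norm_sq, ← sub_nonneg, ← inner_sub_left]
    have : y - z - (p - q) = (y - p) - (z - q) := by abel
    rw [this, inner_sub_left, ← neg_sub q p, inner_neg_right, inner_neg_right]
    rw [← neg_sub q p, inner_neg_right] at h2
    linarith
  have h4 := real_inner_le_norm (y - z) (p - q)
  rcases (norm_nonneg (p - q)).eq_or_lt with h | h
  · rw [← h]; exact norm_nonneg _
  · nlinarith

theorem continuous_coneProj (K : ProperCone ℝ E) : Continuous (coneProj K) := by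
  have : LipschitzWith 1 (coneProj K) := LipschitzWith.of_dist_le_mul fun y z => by
    simpa [dist_eq_norm] using norm_coneProj_sub_le K y z
  exact this.continuous

/-- The right-hand side is a sum over coordinates, so it can be split at an index and each piece
compared with an isotonic fit. -/
theorem norm_coneProj_sq (K : ProperCone ℝ E) (y : E) :
    ‖coneProj K y‖ ^ 2 = 2 * inner ℝ y (coneProj K y) - ‖coneProj K y‖ ^ 2 := by
  have h := inner_sub_coneProj_self K y
  rw [inner_sub_left, real_inner_self_eq_norm_sq] at h
  linarith

end ConeProjection

/-! ### Isotonic regression through partial sums of residuals. -/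

/-- `u` is the isotonic (nondecreasing) least squares fit of `g` on the indices `i < n`,
expressed by the optimality conditions on the partial sums of the residuals. -/
structure IsIsotonicFit (n : ℕ) (g u : ℕ → ℝ) : Prop where
  le_succ : ∀ i, i + 1 < n → u i ≤ u (i + 1)
  sum_nonneg : ∀ t ≤ n, 0 ≤ ∑ i ∈ Finset.range t, (g i - u i)
  sum_eq_zero : ∑ i ∈ Finset.range n, (g i - u i) = 0
  sum_eq_zero_of_lt : ∀ t, t + 1 < n → u t < u (t + 1) →
    ∑ i ∈ Finset.range (t + 1), (g i - u i) = 0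

theorem sum_range_succ_mul_by_parts (d v : ℕ → ℝ) (n : ℕ) :
    ∑ i ∈ Finset.range (n + 1), d i * v i = (∑ i ∈ Finset.range (n + 1), d i) * v n -
      ∑ t ∈ Finset.range n, (∑ i ∈ Finset.range (t + 1), d i) * (v (t + 1) - v t) := by
  induction n with
  | zero => simp
  | succ n ih =>
    rw [Finset.sum_range_succ, ih, Finset.sum_range_succ d (n + 1),
      Finset.sum_range_succ (fun t => (∑ i ∈ Finset.range (t + 1), d i) * (v (t + 1) - v t)) n]
    ring

namespace IsIsotonicFit

variable {n : ℕ} {g u w : ℕ → ℝ}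

theorem mono (h : IsIsotonicFit n g u) {i j : ℕ} (hij : i ≤ j) (hj : j < n) : u i ≤ u j := by
  induction j, hij using Nat.le_induction with
  | base => exact le_rfl
  | succ j hij ih => exact (ih (by omega)).trans (h.le_succ j hj)

/-- Abel summation: the boundary term vanishes, and nonnegative partial sums meet nonnegative
increments of `v` with a minus sign. -/
theorem sum_mul_nonpos (h : IsIsotonicFit n g u) {v : ℕ → ℝ}
    (hv : ∀ i, i + 1 < n → v i ≤ v (i + 1)) :
    ∑ i ∈ Finset.range n, (g i - u i) * v i ≤ 0 := by
  rcases n with _ | n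
  · simp
  rw [sum_range_succ_mul_by_parts, h.sum_eq_zero, zero_mul, zero_sub, neg_nonpos]
  refine Finset.sum_nonneg fun t ht => ?_
  rw [Finset.mem_range] at ht
  exact mul_nonneg (h.sum_nonneg _ (by omega)) (sub_nonneg.2 (hv t (by omega)))

/-- Complementary slackness: in the Abel sum either the increment of `u` or the partial sum of
residuals is zero. -/
theorem sum_mul_self (h : IsIsotonicFit n g u) :
    ∑ i ∈ Finset.range n, (g i - u i) * u i = 0 := by
  rcases n with _ | n
  · simp
  rw [sum_range_succ_mul_by_parts, h.sum_eq_zero, zero_mul, zero_sub, neg_eq_zero]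
  refine Finset.sum_eq_zero fun t ht => ?_
  rw [Finset.mem_range] at ht
  rcases (h.le_succ t (by omega)).eq_or_lt with h1 | h1
  · rw [h1, sub_self, mul_zero]
  · rw [h.sum_eq_zero_of_lt t (by omega) h1, zero_mul]

theorem unique (h : IsIsotonicFit n g u) (h' : IsIsotonicFit n g w) :
    ∀ i < n, u i = w i := by
  have h1 := h.sum_mul_nonpos h'.le_succ
  have h2 := h'.sum_mul_nonpos h.le_succ
  have h3 := h.sum_mul_self
  have h4 := h'.sum_mul_self
  have h5 : ∑ i ∈ Finset.range n, (u i - w i) ^ 2 = 0 := by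
    refine le_antisymm ?_ (Finset.sum_nonneg fun i _ => sq_nonneg _)
    have : ∑ i ∈ Finset.range n, (u i - w i) ^ 2 =
        ∑ i ∈ Finset.range n, (g i - w i) * u i - ∑ i ∈ Finset.range n, (g i - w i) * w i -
        ∑ i ∈ Finset.range n, (g i - u i) * u i + ∑ i ∈ Finset.range n, (g i - u i) * w i := by
      rw [← Finset.sum_sub_distrib, ← Finset.sum_sub_distrib, ← Finset.sum_add_distrib]
      exact Finset.sum_congr rfl fun i _ => by ring
    linarith
  intro i hi
  rw [Finset.sum_eq_zero_iff_of_nonneg fun i _ => sq_nonneg _] at h5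
  exact sub_eq_zero.1 (pow_eq_zero_iff two_ne_zero |>.1 (h5 i (Finset.mem_range.2 hi)))

/-- The difference of the two sides is `2⟨g - u, v⟩ - ‖u - v‖²`. This is how an arbitrary monotone
competitor is dominated by the fit. -/
theorem sum_le_sum_sq (h : IsIsotonicFit n g u) {v : ℕ → ℝ}
    (hv : ∀ i, i + 1 < n → v i ≤ v (i + 1)) :
    ∑ i ∈ Finset.range n, (2 * (g i * v i) - v i ^ 2) ≤ ∑ i ∈ Finset.range n, u i ^ 2 := by
  have h1 := h.sum_mul_nonpos hv
  have h2 : ∑ i ∈ Finset.range n, (2 * (g i * v i) - v i ^ 2) - ∑ i ∈ Finset.range n, u i ^ 2 =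
      2 * ∑ i ∈ Finset.range n, (g i - u i) * v i - ∑ i ∈ Finset.range n, (u i - v i) ^ 2 := by
    rw [← Finset.sum_sub_distrib, Finset.mul_sum, ← Finset.sum_sub_distrib]
    exact Finset.sum_congr rfl fun i _ => by ring
  have h3 : 0 ≤ ∑ i ∈ Finset.range n, (u i - v i) ^ 2 := Finset.sum_nonneg fun i _ => sq_nonneg _
  linarith

end IsIsotonicFit

/-! ### Existence of the isotonic fit. -/

/-- The cone of nondecreasing sequences. -/
def monotoneCone (n : ℕ) : ProperCone ℝ (EuclideanSpace ℝ (Fin n)) where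
  carrier := {u | ∀ i j : Fin n, i ≤ j → u i ≤ u j}
  zero_mem' := fun i j _ => le_rfl
  add_mem' := fun hu hv i j hij => add_le_add (hu i j hij) (hv i j hij)
  smul_mem' := fun c _ hu i j hij => mul_le_mul_of_nonneg_left (hu i j hij) c.2
  isClosed' := by
    have h : ∀ i j : Fin n, i ≤ j → IsClosed {u : EuclideanSpace ℝ (Fin n) | u i ≤ u j} :=
      fun i j _ => isClosed_le (by fun_prop) (by fun_prop)
    have h' := isClosed_iInter fun i => isClosed_iInter fun j => isClosed_iInter fun hij => h i j hij
    convert h' using 1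
    ext u
    simp only [Set.mem_iInter]
    rfl

/-- The initial segment of length `n` of a sequence, as a vector of `ℝⁿ`. -/
noncomputable def initialVector (n : ℕ) (g : ℕ → ℝ) : EuclideanSpace ℝ (Fin n) :=
  WithLp.toLp 2 fun i : Fin n => g i

theorem measurable_initialVector (n : ℕ) : Measurable (initialVector n) := by
  unfold initialVector; fun_prop

/-- The isotonic least squares fit of the first `n` terms of a sequence, extended by `0`. -/
noncomputable def isotonicFit (n : ℕ) (g : ℕ → ℝ) (i : ℕ) : ℝ :=
  if h : i < n then coneProj (monotoneCone n) (initialVector n g) ⟨i, h⟩ else 0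

theorem measurable_isotonicFit (n i : ℕ) : Measurable fun g => isotonicFit n g i := by
  unfold isotonicFit
  by_cases h : i < n
  · simp only [h, dite_true]
    exact ((EuclideanSpace.proj (𝕜 := ℝ) (⟨i, h⟩ : Fin n)).continuous.comp
      (continuous_coneProj _)).measurable.comp (measurable_initialVector n)
  · simp only [h, dite_false]
    exact measurable_const

theorem isotonicFit_congr {n : ℕ} {g h : ℕ → ℝ} (hgh : ∀ i < n, g i = h i) :
    isotonicFit n g = isotonicFit n h := by
  have : initialVector n g = initialVector n h := by
    unfold initialVector
    congr 1
    ext i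
    exact hgh i i.2
  unfold isotonicFit
  rw [this]

theorem sum_range_add_sum_filter_le {n t : ℕ} (ht : t ≤ n) (d : ℕ → ℝ) :
    ∑ i ∈ Finset.range t, d i + ∑ i ∈ Finset.range n, (if t ≤ i then d i else 0) =
      ∑ i ∈ Finset.range n, d i := by
  rw [← Finset.sum_filter, ← Finset.sum_range_add_sum_Ico d ht]
  congr 2
  ext i
  simp
  omega

theorem isIsotonicFit_isotonicFit (n : ℕ) (g : ℕ → ℝ) : IsIsotonicFit n g (isotonicFit n g) := by
  set y := initialVector n g with hy
  set p := coneProj (monotoneCone n) y with hp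
  have hu : ∀ i (h : i < n), isotonicFit n g i = p ⟨i, h⟩ := fun i h => by
    simp [isotonicFit, h, hp, hy]
  have hmem : p ∈ monotoneCone n := (coneProj_spec _ y).1
  have hmono : ∀ i j, i ≤ j → j < n → isotonicFit n g i ≤ isotonicFit n g j := fun i j hij hj => by
    rw [hu i (by omega), hu j hj]
    exact hmem _ _ hij
  have hinner : ∀ v : ℕ → ℝ, inner ℝ (y - p) (initialVector n v) =
      ∑ i ∈ Finset.range n, (g i - isotonicFit n g i) * v i := fun v => by
    rw [PiLp.inner_apply, Finset.sum_range]
    refine Finset.sum_congr rfl fun i _ => ?_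
    rw [hu i i.2]
    simp [hy, initialVector, mul_comm]
  have hself : initialVector n (isotonicFit n g) = p := by
    ext i
    exact hu i i.2
  have hle : ∀ v : ℕ → ℝ, (∀ i j, i ≤ j → j < n → v i ≤ v j) →
      ∑ i ∈ Finset.range n, (g i - isotonicFit n g i) * v i ≤ 0 := fun v hv => by
    rw [← hinner]
    exact inner_sub_coneProj_nonpos _ _ fun i j hij => hv i j hij j.2
  have h0 : ∑ i ∈ Finset.range n, (g i - isotonicFit n g i) * isotonicFit n g i = 0 := by
    rw [← hinner, hself]
    exact inner_sub_coneProj_self _ _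
  have hsum : ∑ i ∈ Finset.range n, (g i - isotonicFit n g i) = 0 := by
    have h1 := hle (fun _ => 1) fun _ _ _ _ => le_rfl
    have h2 := hle (fun _ => -1) fun _ _ _ _ => le_rfl
    simp only [mul_one, mul_neg, Finset.sum_neg_distrib] at h1 h2
    linarith
  have hnn : ∀ t ≤ n, 0 ≤ ∑ i ∈ Finset.range t, (g i - isotonicFit n g i) := fun t ht => by
    have h1 := hle (fun i => if t ≤ i then 1 else 0) fun i j hij _ => by
      split_ifs <;> first | omega | norm_num
    have h2 := sum_range_add_sum_filter_le ht fun i => g i - isotonicFit n g i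
    simp only [mul_ite, mul_one, mul_zero] at h1
    linarith
  refine ⟨fun i hi => hmono _ _ (by omega) hi, hnn, hsum, fun t ht hlt => ?_⟩
  refine le_antisymm ?_ (hnn _ ht.le)
  set ε := isotonicFit n g (t + 1) - isotonicFit n g t with hε
  -- Lowering everything after `t` by exactly the jump `ε` keeps the fit monotone. Testing against
  -- this makes the tail of the residuals sum to something nonnegative; as the total is zero, the
  -- initial sum is nonpositive.
  have h1 := hle (fun i => isotonicFit n g i - ε * if t + 1 ≤ i then 1 else 0) fun i j hij hj => by
    have h := hmono i j hij hj
    split_ifs with h1 h2 h2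
    · linarith
    · omega
    · have h3 := hmono i t (by omega) (by omega)
      have h4 := hmono (t + 1) j h2 hj
      linarith
    · linarith
  have h2 := sum_range_add_sum_filter_le ht.le fun i => g i - isotonicFit n g i
  have h3 : ∑ i ∈ Finset.range n, (g i - isotonicFit n g i) *
      (isotonicFit n g i - ε * if t + 1 ≤ i then 1 else 0) =
      ∑ i ∈ Finset.range n, (g i - isotonicFit n g i) * isotonicFit n g i -
      ε * ∑ i ∈ Finset.range n, (if t + 1 ≤ i then g i - isotonicFit n g i else 0) := by
    rw [Finset.mul_sum, ← Finset.sum_sub_distrib]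
    refine Finset.sum_congr rfl fun i _ => ?_
    split_ifs <;> ring
  rw [h3, h0, zero_sub, neg_nonpos] at h1
  have h4 := nonneg_of_mul_nonneg_right h1 (sub_pos.2 hlt)
  linarith

/-! ### Level blocks of the fit and their deletion. -/

/-- The mean of the first `k` terms of a sequence. -/
noncomputable def blockMean (k : ℕ) (b : ℕ → ℝ) : ℝ := (∑ i ∈ Finset.range k, b i) / k

/-- All partial sums of the centred first `k` terms are nonnegative. -/
def IsBridge (k : ℕ) (b : ℕ → ℝ) : Prop :=
  ∀ t ≤ k, 0 ≤ ∑ i ∈ Finset.range t, (b i - blockMean k b)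

/-- The index map deleting the block `[j, j + k)`. -/
def deleteBlock (j k i : ℕ) : ℕ := if i < j then i else i + k

/-- The permutation of indices that moves the block `[j, j + k)` to the front. -/
def blockToFront (j k s : ℕ) : ℕ :=
  if s < k then j + s else if s < k + j then s - k else s

theorem blockToFront_injective (j k : ℕ) : Function.Injective (blockToFront j k) := by
  intro a b h
  unfold blockToFront at h
  split_ifs at h <;> omega

theorem blockToFront_of_lt {j k s : ℕ} (h : s < k) : blockToFront j k s = j + s := by
  simp [blockToFront, h]

theorem blockToFront_add (j k i : ℕ) : blockToFront j k (k + i) = deleteBlock j k i := by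
  unfold blockToFront deleteBlock
  split_ifs <;> omega

theorem sum_range_deleteBlock_of_le {j k t : ℕ} (ht : t ≤ j) (f : ℕ → ℝ) :
    ∑ i ∈ Finset.range t, f (deleteBlock j k i) = ∑ i ∈ Finset.range t, f i := by
  refine Finset.sum_congr rfl fun i hi => ?_
  rw [Finset.mem_range] at hi
  rw [deleteBlock, if_pos (by omega)]

theorem sum_range_deleteBlock_add (j k s : ℕ) (f : ℕ → ℝ) :
    ∑ i ∈ Finset.range (j + s), f (deleteBlock j k i) + ∑ i ∈ Finset.range k, f (j + i) =
      ∑ i ∈ Finset.range (j + s + k), f i := by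
  have h1 : j + s + k = j + k + s := by omega
  rw [h1, Finset.sum_range_add, Finset.sum_range_add f (j + k), Finset.sum_range_add f j k,
    sum_range_deleteBlock_of_le le_rfl]
  have h2 : ∀ i, f (deleteBlock j k (j + i)) = f (j + k + i) := fun i => by
    rw [deleteBlock, if_neg (by omega)]
    congr 1
    omega
  simp only [h2]
  ring

/-- The block `[j, j + k)` of indices is the level set `{u = c}` of a nondecreasing sequence `u`
of length `r + k`. -/
structure IsLevelBlock (r k j : ℕ) (u : ℕ → ℝ) (c : ℝ) : Prop where
  pos : 0 < k
  le : j ≤ r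
  lt : ∀ i < j, u i < c
  eq : ∀ i < k, u (j + i) = c
  gt : ∀ i, j + k ≤ i → i < r + k → c < u i

namespace IsLevelBlock

variable {r k j : ℕ} {g u : ℕ → ℝ} {c : ℝ}

theorem sum_left_eq_zero (hb : IsLevelBlock r k j u c) (h : IsIsotonicFit (r + k) g u) :
    ∑ i ∈ Finset.range j, (g i - u i) = 0 := by
  have hk := hb.pos
  have hj := hb.le
  rcases j with _ | j
  · simp
  · refine h.sum_eq_zero_of_lt j (by omega) ?_
    have := hb.eq 0 hk
    rw [add_zero] at this
    rw [this]
    exact hb.lt j (by omega)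

theorem sum_right_eq_zero (hb : IsLevelBlock r k j u c) (h : IsIsotonicFit (r + k) g u) :
    ∑ i ∈ Finset.range (j + k), (g i - u i) = 0 := by
  have hk := hb.pos
  rcases hb.le.eq_or_lt with hj | hj
  · rw [hj]; exact h.sum_eq_zero
  · obtain ⟨l, rfl⟩ : ∃ l, k = l + 1 := ⟨k - 1, by omega⟩
    refine h.sum_eq_zero_of_lt (j + l) (by omega) ?_
    rw [hb.eq l (by omega)]
    exact hb.gt _ (by omega) (by omega)

theorem sum_block (hb : IsLevelBlock r k j u c) (h : IsIsotonicFit (r + k) g u) {t : ℕ}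
    (ht : t ≤ k) :
    ∑ i ∈ Finset.range t, (g (j + i) - c) = ∑ i ∈ Finset.range (j + t), (g i - u i) := by
  rw [Finset.sum_range_add, hb.sum_left_eq_zero h, zero_add]
  refine Finset.sum_congr rfl fun i hi => ?_
  rw [Finset.mem_range] at hi
  rw [hb.eq i (by omega)]

theorem blockMean_eq (hb : IsLevelBlock r k j u c) (h : IsIsotonicFit (r + k) g u) :
    blockMean k (fun s => g (blockToFront j k s)) = c := by
  have h1 := hb.sum_block h le_rfl
  rw [hb.sum_right_eq_zero h, Finset.sum_sub_distrib, Finset.sum_const, Finset.card_range,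
    nsmul_eq_mul] at h1
  have h2 : ∑ i ∈ Finset.range k, g (blockToFront j k i) = ∑ i ∈ Finset.range k, g (j + i) :=
    Finset.sum_congr rfl fun i hi => by rw [blockToFront_of_lt (Finset.mem_range.1 hi)]
  have hk : (k : ℝ) ≠ 0 := Nat.cast_ne_zero.2 hb.pos.ne'
  rw [blockMean, h2, div_eq_iff hk]
  linarith

theorem isBridge (hb : IsLevelBlock r k j u c) (h : IsIsotonicFit (r + k) g u) :
    IsBridge k (fun s => g (blockToFront j k s)) := by
  intro t ht
  rw [hb.blockMean_eq h]
  have h2 : ∑ i ∈ Finset.range t, (g (blockToFront j k i) - c) =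
      ∑ i ∈ Finset.range t, (g (j + i) - c) :=
    Finset.sum_congr rfl fun i hi => by
      rw [blockToFront_of_lt ((Finset.mem_range.1 hi).trans_le ht)]
  have hj := hb.le
  rw [h2, hb.sum_block h ht]
  exact h.sum_nonneg _ (by omega)

/-- The residuals of the block sum to zero, so each partial sum after deletion is a partial sum of
the original residuals. Only the new junction at `j` needs an argument: the sum to the left of the
block vanishes there. -/
theorem isIsotonicFit_delete (hb : IsLevelBlock r k j u c) (h : IsIsotonicFit (r + k) g u) :
    IsIsotonicFit r (fun i => g (deleteBlock j k i)) (fun i => u (deleteBlock j k i)) := by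
  have hj := hb.le
  have hk := hb.pos
  have hblock : ∑ i ∈ Finset.range k, (g (j + i) - u (j + i)) = 0 := by
    have := hb.sum_right_eq_zero h
    rwa [Finset.sum_range_add, hb.sum_left_eq_zero h, zero_add] at this
  have hright : ∀ t, j ≤ t → ∑ i ∈ Finset.range t, (g (deleteBlock j k i) - u (deleteBlock j k i)) =
      ∑ i ∈ Finset.range (t + k), (g i - u i) := by
    intro t ht
    obtain ⟨s, rfl⟩ := Nat.exists_eq_add_of_le ht
    have := sum_range_deleteBlock_add j k s fun i => g i - u i
    rwa [hblock, add_zero] at this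
  have hleft : ∀ t ≤ j, ∑ i ∈ Finset.range t, (g (deleteBlock j k i) - u (deleteBlock j k i)) =
      ∑ i ∈ Finset.range t, (g i - u i) := fun t ht =>
    sum_range_deleteBlock_of_le ht fun i => g i - u i
  refine ⟨fun i hi => ?_, fun t ht => ?_, ?_, fun t ht hlt => ?_⟩
  · refine h.mono ?_ ?_ <;> unfold deleteBlock <;> split_ifs <;> omega
  · rcases le_total t j with htj | htj
    · rw [hleft t htj]; exact h.sum_nonneg _ (by omega)
    · rw [hright t htj]; exact h.sum_nonneg _ (by omega)
  · rw [hright r hj]; exact h.sum_eq_zero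
  · rcases lt_trichotomy (t + 1) j with htj | htj | htj
    · rw [hleft _ htj.le]
      refine h.sum_eq_zero_of_lt t (by omega) ?_
      simpa [deleteBlock, htj, (Nat.lt_succ_self t).trans htj] using hlt
    · rw [hleft _ htj.le, htj]
      exact hb.sum_left_eq_zero h
    · rw [hright _ htj.le, add_right_comm]
      refine h.sum_eq_zero_of_lt (t + k) (by omega) ?_
      simpa [deleteBlock, show ¬ t + 1 < j by omega, show ¬ t < j by omega,
        add_right_comm t 1 k] using hlt

theorem sum_sq (hb : IsLevelBlock r k j u c) :
    ∑ i ∈ Finset.range (r + k), u i ^ 2 =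
      k * c ^ 2 + ∑ i ∈ Finset.range r, u (deleteBlock j k i) ^ 2 := by
  obtain ⟨s, rfl⟩ := Nat.exists_eq_add_of_le hb.le
  rw [← sum_range_deleteBlock_add j k s fun i => u i ^ 2, add_comm]
  congr 1
  rw [Finset.sum_congr rfl fun i hi => by rw [hb.eq i (Finset.mem_range.1 hi)]]
  simp

theorem lt_iff (hb : IsLevelBlock r k j u c) {i : ℕ} (hi : i < r) :
    u (deleteBlock j k i) < c ↔ i < j := by
  unfold deleteBlock
  split_ifs with h
  · simp [h, hb.lt i h]
  · simp [h, (hb.gt (i + k) (by omega) (by omega)).le]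

end IsLevelBlock

theorem exists_isLevelBlock {n : ℕ} {u : ℕ → ℝ} (hu : ∀ i j, i ≤ j → j < n → u i ≤ u j)
    {i₀ : ℕ} (hi₀ : i₀ < n) :
    ∃ r j, r < n ∧ j < r + 1 ∧ j ≤ i₀ ∧ i₀ < j + (n - r) ∧ IsLevelBlock r (n - r) j u (u i₀) := by
  classical
  -- The least such `j` starts the level set of `u i₀`; the least `e` below is one past its end,
  -- with `n` itself as fallback.
  have hj : ∃ j, u i₀ ≤ u j := ⟨i₀, le_rfl⟩
  have he : ∃ e, n ≤ e ∨ u i₀ < u e := ⟨n, Or.inl le_rfl⟩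
  have hj1 := Nat.find_spec hj
  have hj2 : ∀ i < Nat.find hj, u i < u i₀ := fun i hi => not_le.1 (Nat.find_min hj hi)
  have hj3 : Nat.find hj ≤ i₀ := Nat.find_le le_rfl
  have he1 := Nat.find_spec he
  have he2 : ∀ i < Nat.find he, ¬ (n ≤ i ∨ u i₀ < u i) := fun i hi => Nat.find_min he hi
  have he3 : Nat.find he ≤ n := Nat.find_le (Or.inl le_rfl)
  generalize Nat.find hj = j at *
  generalize Nat.find he = e at *
  have hie : i₀ < e := by
    by_contra hcon
    rcases he1 with h | h
    · omega
    · exact absurd (hu e i₀ (by omega) hi₀) (not_le.2 h)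
  refine ⟨n - (e - j), j, by omega, by omega, hj3, by omega, by omega, by omega, hj2, ?_, ?_⟩
  · intro i hi
    have h1 := he2 (j + i) (by omega)
    push Not at h1
    exact le_antisymm h1.2 (hj1.trans (hu _ _ (by omega) h1.1))
  · intro i hi hin
    rcases he1 with h | h
    · omega
    · exact h.trans_le (hu _ _ (by omega) (by omega))

/-! ### Exponential weights and their decomposition over level blocks. -/

/-- The exponential of `3/8` times the squared norm of the isotonic fit. -/
noncomputable def fitWeight (n : ℕ) (g : ℕ → ℝ) : ℝ≥0∞ :=
  ENNReal.ofReal (Real.exp (3 / 8 * ∑ i ∈ Finset.range n, isotonicFit n g i ^ 2))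

/-- The exponential of `3/8` times the squared norm of the projection onto constants of the
first `k` terms. -/
noncomputable def meanWeight (k : ℕ) (b : ℕ → ℝ) : ℝ≥0∞ :=
  ENNReal.ofReal (Real.exp (3 / 8 * (k * blockMean k b ^ 2)))

open Classical in
/-- The contribution of bridges to `meanWeight`. -/
noncomputable def bridgeWeight (k : ℕ) (b : ℕ → ℝ) : ℝ≥0∞ :=
  if IsBridge k b then meanWeight k b else 0

/-- The mean of the first `k` terms can be inserted before position `j` of the isotonic fit of the
following `r` terms. -/
def IsCut (r k j : ℕ) (b : ℕ → ℝ) : Prop :=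
  ∀ i < r, isotonicFit r (fun s => b (k + s)) i < blockMean k b ↔ i < j

open Classical in
/-- The contribution to `fitWeight` of a level block of size `k` starting at `j`. -/
noncomputable def blockWeight (r k j : ℕ) (b : ℕ → ℝ) : ℝ≥0∞ :=
  if IsCut r k j b then bridgeWeight k b * fitWeight r (fun s => b (k + s)) else 0

/-- Moving the block to the front separates it from the other data, and the squared norm is additive
over the two segments, so the weight factors. The cut condition records where the block came from.
-/
theorem fitWeight_eq_blockWeight {r k j : ℕ} {g : ℕ → ℝ} {c : ℝ}
    (hb : IsLevelBlock r k j (isotonicFit (r + k) g) c) :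
    fitWeight (r + k) g = blockWeight r k j (fun s => g (blockToFront j k s)) := by
  have h := isIsotonicFit_isotonicFit (r + k) g
  have hfit : ∀ i < r, isotonicFit r (fun s => g (blockToFront j k (k + s))) i =
      isotonicFit (r + k) g (deleteBlock j k i) := by
    have h2 := isIsotonicFit_isotonicFit r (fun s => g (blockToFront j k (k + s)))
    refine h2.unique ?_
    simp only [blockToFront_add]
    exact hb.isIsotonicFit_delete h
  have hcut : IsCut r k j (fun s => g (blockToFront j k s)) := fun i hi => by
    rw [hfit i hi, hb.blockMean_eq h]
    exact hb.lt_iff hi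
  rw [blockWeight, if_pos hcut, bridgeWeight, if_pos (hb.isBridge h), meanWeight, fitWeight,
    fitWeight, hb.blockMean_eq h, hb.sum_sq, ← ENNReal.ofReal_mul (Real.exp_pos _).le,
    ← Real.exp_add, ← mul_add]
  have hsum : ∑ i ∈ Finset.range r, isotonicFit (r + k) g (deleteBlock j k i) ^ 2 =
      ∑ i ∈ Finset.range r, isotonicFit r (fun s => g (blockToFront j k (k + s))) i ^ 2 :=
    Finset.sum_congr rfl fun i hi => by rw [hfit i (Finset.mem_range.1 hi)]
  rw [hsum]

/-- Double counting: every index lies in a level block, and a block of length `n - r` is found from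
at most `n - r` indices. This factor later cancels the gain of the cycle lemma. -/
theorem nsmul_fitWeight_le (n : ℕ) (g : ℕ → ℝ) :
    (n : ℝ≥0∞) * fitWeight n g ≤ ∑ r ∈ Finset.range n, ∑ j ∈ Finset.range (r + 1),
      ((n - r : ℕ) : ℝ≥0∞) * blockWeight r (n - r) j (fun s => g (blockToFront j (n - r) s)) := by
  set W : ℕ → ℕ → ℝ≥0∞ := fun r j =>
    blockWeight r (n - r) j (fun s => g (blockToFront j (n - r) s)) with hW
  calc (n : ℝ≥0∞) * fitWeight n g = ∑ i₀ ∈ Finset.range n, fitWeight n g := by simp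
    _ ≤ ∑ i₀ ∈ Finset.range n, ∑ r ∈ Finset.range n, ∑ j ∈ Finset.range (r + 1),
        (if j ≤ i₀ ∧ i₀ < j + (n - r) then W r j else 0) := by
      refine Finset.sum_le_sum fun i₀ hi₀ => ?_
      rw [Finset.mem_range] at hi₀
      obtain ⟨r, j, hr, hj, h1, h2, hb⟩ := exists_isLevelBlock
        (fun i j => (isIsotonicFit_isotonicFit n g).mono) hi₀
      have hn : r + (n - r) = n := by omega
      have heq : fitWeight n g = W r j := by
        have := fitWeight_eq_blockWeight (r := r) (k := n - r) (j := j) (g := g)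
          (c := isotonicFit n g i₀) (by rw [hn]; exact hb)
        rwa [hn] at this
      calc fitWeight n g = if j ≤ i₀ ∧ i₀ < j + (n - r) then W r j else 0 := by
            rw [if_pos ⟨h1, h2⟩, heq]
        _ ≤ ∑ j ∈ Finset.range (r + 1), (if j ≤ i₀ ∧ i₀ < j + (n - r) then W r j else 0) :=
            Finset.single_le_sum
              (f := fun j => if j ≤ i₀ ∧ i₀ < j + (n - r) then W r j else 0)
              (fun _ _ => zero_le) (Finset.mem_range.2 hj)
        _ ≤ _ := Finset.single_le_sum
              (f := fun r => ∑ j ∈ Finset.range (r + 1),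
                if j ≤ i₀ ∧ i₀ < j + (n - r) then W r j else 0)
              (fun _ _ => zero_le) (Finset.mem_range.2 hr)
    _ = ∑ r ∈ Finset.range n, ∑ j ∈ Finset.range (r + 1), ∑ i₀ ∈ Finset.range n,
        (if j ≤ i₀ ∧ i₀ < j + (n - r) then W r j else 0) := by
      rw [Finset.sum_comm]
      exact Finset.sum_congr rfl fun r _ => Finset.sum_comm
    _ ≤ _ := by
      refine Finset.sum_le_sum fun r _ => Finset.sum_le_sum fun j _ => ?_
      rw [← Finset.sum_filter, Finset.sum_const, nsmul_eq_mul]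
      gcongr
      calc _ ≤ (Finset.Ico j (j + (n - r))).card := Finset.card_le_card fun i hi => by
            simpa using (Finset.mem_filter.1 hi).2
        _ = n - r := by simp

/-- At most one `j` survives: if two positions were cuts, they would disagree on whether the fit at
the smaller one lies below the block mean. -/
theorem sum_blockWeight_le (r k : ℕ) (b : ℕ → ℝ) :
    ∑ j ∈ Finset.range (r + 1), blockWeight r k j b ≤
      bridgeWeight k b * fitWeight r (fun s => b (k + s)) := by
  classical
  by_cases h : ∃ j ∈ Finset.range (r + 1), IsCut r k j b
  · obtain ⟨j, hj, hcut⟩ := h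
    rw [Finset.sum_eq_single_of_mem j hj, blockWeight, if_pos hcut]
    intro j' hj' hne
    rw [blockWeight, if_neg]
    intro hcut'
    rw [Finset.mem_range] at hj hj'
    rcases lt_or_gt_of_ne hne with hlt | hlt
    · have h2 := (hcut j' (by omega)).2 hlt
      have h3 := (hcut' j' (by omega)).1 h2
      omega
    · have h2 := (hcut' j (by omega)).2 hlt
      have h3 := (hcut j (by omega)).1 h2
      omega
  · push Not at h
    rw [Finset.sum_eq_zero fun j hj => by rw [blockWeight, if_neg (h j hj)]]
    exact zero_le

/-! ### Gaussian sequences: invariance, linear forms, measurability. -/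

/-- The law of an i.i.d. sequence of standard Gaussian variables. -/
noncomputable def gaussianSequence : Measure (ℕ → ℝ) :=
  Measure.infinitePi fun _ => gaussianReal 0 1

instance : IsProbabilityMeasure gaussianSequence := by
  unfold gaussianSequence; infer_instance

theorem iIndepFun_gaussianSequence : iIndepFun (fun i (g : ℕ → ℝ) => g i) gaussianSequence :=
  iIndepFun_infinitePi (X := fun _ x => x) (by fun_prop)

/-- Working with an infinite sequence lets block moves, cyclic shifts, reversals and translations
all preserve the law by injectivity alone. -/
theorem map_gaussianSequence_comp {σ : ℕ → ℕ} (hσ : Function.Injective σ) :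
    gaussianSequence.map (fun g s => g (σ s)) = gaussianSequence :=
  Measure.map_infinitePi_infinitePi_of_inj hσ

theorem lintegral_gaussianSequence_comp {σ : ℕ → ℕ} (hσ : Function.Injective σ)
    {f : (ℕ → ℝ) → ℝ≥0∞} (hf : Measurable f) :
    ∫⁻ g, f (fun s => g (σ s)) ∂gaussianSequence = ∫⁻ g, f g ∂gaussianSequence := by
  conv_rhs => rw [← map_gaussianSequence_comp hσ]
  rw [lintegral_map hf (by fun_prop)]

theorem map_gaussianSequence_initialVector (n : ℕ) :
    gaussianSequence.map (initialVector n) = stdGaussian (EuclideanSpace ℝ (Fin n)) := by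
  have h : initialVector n = WithLp.toLp 2 ∘ fun (g : ℕ → ℝ) (i : Fin n) => g i := rfl
  rw [h, ← Measure.map_map (by fun_prop) (by fun_prop), ← map_pi_eq_stdGaussian,
    ← Measure.infinitePi_eq_pi]
  congr 1
  exact Measure.map_infinitePi_infinitePi_of_inj Fin.val_injective

theorem map_gaussianSequence_sum (s : Finset ℕ) (a : ℕ → ℝ) :
    gaussianSequence.map (fun g => ∑ i ∈ s, a i * g i) =
      gaussianReal 0 (∑ i ∈ s, Real.toNNReal (a i ^ 2)) := by
  classical
  have h : (fun g : ℕ → ℝ => ∑ i ∈ s, a i * g i) = ∑ i ∈ s, fun g => a i * g i := by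
    ext g
    simp
  rw [h]
  clear h
  induction s using Finset.induction_on with
  | empty =>
    simp only [Finset.sum_empty, gaussianReal_zero_var]
    change gaussianSequence.map (fun _ => (0 : ℝ)) = _
    simp [Measure.map_const]
  | insert i s hi ih =>
    rw [Finset.sum_insert hi, Finset.sum_insert hi, ← add_zero (0 : ℝ)]
    refine gaussianReal_add_gaussianReal_of_indepFun ?_ ?_ ih
    · have h := iIndepFun_gaussianSequence.comp (fun i x => a i * x) (fun i => by fun_prop)
      exact (h.indepFun_finsetSum_of_notMem (fun i => by fun_prop) hi).symm
    · have h1 : gaussianSequence.map (fun g => g i) = gaussianReal 0 1 :=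
        Measure.infinitePi_map_eval _ i
      have h2 := gaussianReal_map_const_mul (μ := 0) (v := 1) (a i)
      rw [← h1, Measure.map_map (by fun_prop) (by fun_prop), mul_zero, mul_one] at h2
      convert h2 using 2
      · rfl
      · exact Real.toNNReal_of_nonneg (sq_nonneg _)

theorem ae_sum_mul_ne_zero {s : Finset ℕ} {a : ℕ → ℝ} {i : ℕ} (hi : i ∈ s) (ha : a i ≠ 0) :
    ∀ᵐ g ∂gaussianSequence, ∑ i ∈ s, a i * g i ≠ 0 := by
  have hv : ∑ i ∈ s, Real.toNNReal (a i ^ 2) ≠ 0 := by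
    intro h
    rw [Finset.sum_eq_zero_iff] at h
    have := h i hi
    rw [Real.toNNReal_eq_zero] at this
    exact absurd this (not_le.2 (by positivity))
  have h0 : gaussianSequence.map (fun g => ∑ i ∈ s, a i * g i) {0} = 0 := by
    rw [map_gaussianSequence_sum]
    have := nullSingletonClass_gaussianReal (μ := 0) hv
    exact measure_singleton 0
  rw [Measure.map_apply (Finset.measurable_sum _ fun i _ => by fun_prop)
    (measurableSet_singleton 0)] at h0
  rw [ae_iff]
  convert h0 using 2
  ext g
  simp

/-- The exponent `-x²/2 + 3x²/8 = -x²/8` is that of a Gaussian of standard deviation `2`. The rate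
`3/8` is tuned to this value `2`. -/
theorem lintegral_exp_sq_gaussianReal :
    ∫⁻ x, ENNReal.ofReal (Real.exp (3 / 8 * x ^ 2)) ∂(gaussianReal 0 1) = 2 := by
  rw [gaussianReal_of_var_ne_zero _ one_ne_zero,
    lintegral_withDensity_eq_lintegral_mul _ (measurable_gaussianPDF _ _) (by fun_prop)]
  have h : ∀ x : ℝ, (gaussianPDF 0 1 * fun x => ENNReal.ofReal (Real.exp (3 / 8 * x ^ 2))) x =
      ENNReal.ofReal ((√(2 * Real.pi))⁻¹ * Real.exp (-(1 / 8) * x ^ 2)) := fun x => by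
    rw [Pi.mul_apply, gaussianPDF, ← ENNReal.ofReal_mul (gaussianPDFReal_nonneg _ _ _),
      gaussianPDFReal_def]
    simp only [NNReal.coe_one, mul_one, sub_zero]
    rw [mul_assoc, ← Real.exp_add]
    congr 3
    ring
  simp_rw [h]
  rw [← ofReal_integral_eq_lintegral_ofReal
    ((integrable_exp_neg_mul_sq (by norm_num)).const_mul _)
    (Filter.Eventually.of_forall fun x => by positivity), integral_const_mul, integral_gaussian]
  have h8 : Real.pi / (1 / 8) = 2 ^ 2 * (2 * Real.pi) := by ring
  rw [h8, Real.sqrt_mul (sq_nonneg 2) (2 * Real.pi), Real.sqrt_sq zero_le_two, mul_left_comm,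
    inv_mul_cancel₀ (by positivity)]
  simp

theorem measurable_blockMean (k : ℕ) : Measurable (blockMean k) := by
  unfold blockMean
  exact (Finset.measurable_sum _ fun i _ => by fun_prop).div_const _

theorem measurable_meanWeight (k : ℕ) : Measurable (meanWeight k) := by
  unfold meanWeight
  have := measurable_blockMean k
  fun_prop

theorem measurableSet_isBridge (k : ℕ) : MeasurableSet {b | IsBridge k b} := by
  have h : {b | IsBridge k b} = ⋂ t : ℕ, ⋂ _ : t ≤ k,
      {b : ℕ → ℝ | 0 ≤ ∑ i ∈ Finset.range t, (b i - blockMean k b)} := by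
    ext b
    simp [IsBridge]
  rw [h]
  have := measurable_blockMean k
  refine MeasurableSet.iInter fun t => MeasurableSet.iInter fun _ =>
    measurableSet_le measurable_const ?_
  exact Finset.measurable_sum _ fun i _ => (measurable_pi_apply i).sub this

theorem measurable_bridgeWeight (k : ℕ) : Measurable (bridgeWeight k) :=
  Measurable.ite (measurableSet_isBridge k) (measurable_meanWeight k) measurable_const

theorem measurable_fitWeight (n : ℕ) : Measurable (fitWeight n) := by
  unfold fitWeight
  have : Measurable fun g : ℕ → ℝ => ∑ i ∈ Finset.range n, isotonicFit n g i ^ 2 :=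
    Finset.measurable_sum _ fun i _ => (measurable_isotonicFit n i).pow_const 2
  fun_prop

theorem measurableSet_isCut (r k j : ℕ) : MeasurableSet {b | IsCut r k j b} := by
  have h : {b | IsCut r k j b} = ⋂ i : ℕ, ⋂ _ : i < r,
      {b : ℕ → ℝ | isotonicFit r (fun s => b (k + s)) i < blockMean k b ↔ i < j} := by
    ext b
    simp [IsCut]
  rw [h]
  refine MeasurableSet.iInter fun i => MeasurableSet.iInter fun _ => ?_
  have hm : MeasurableSet {b : ℕ → ℝ | isotonicFit r (fun s => b (k + s)) i < blockMean k b} :=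
    measurableSet_lt ((measurable_isotonicFit r i).comp (by fun_prop)) (measurable_blockMean k)
  by_cases hij : i < j
  · simpa [hij] using hm
  · simp only [hij, iff_false]
    exact hm.compl

theorem measurable_blockWeight (r k j : ℕ) : Measurable (blockWeight r k j) :=
  Measurable.ite (measurableSet_isCut r k j)
    ((measurable_bridgeWeight k).mul ((measurable_fitWeight r).comp (by fun_prop)))
    measurable_const

/-- The variable `√k * blockMean k b` is standard normal. -/
theorem lintegral_meanWeight {k : ℕ} (hk : 0 < k) :
    ∫⁻ b, meanWeight k b ∂gaussianSequence = 2 := by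
  have hk' : (0 : ℝ) < k := Nat.cast_pos.2 hk
  have hlaw := map_gaussianSequence_sum (Finset.range k) fun _ => (√k)⁻¹
  have hv : ∑ i ∈ Finset.range k, Real.toNNReal ((√(k : ℝ))⁻¹ ^ 2) = 1 := by
    ext
    simp [hk'.ne']
  rw [hv] at hlaw
  rw [← lintegral_exp_sq_gaussianReal, ← hlaw,
    lintegral_map (by fun_prop) (Finset.measurable_sum _ fun i _ => by fun_prop)]
  refine lintegral_congr fun b => ?_
  rw [meanWeight, ← Finset.mul_sum, mul_pow, inv_pow, Real.sq_sqrt hk'.le,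
    blockMean, div_pow]
  congr 3
  field_simp

/-! ### The cycle lemma for bridges. -/

/-- Cyclic shift by `r` of the first `k` indices. -/
def cyclicShift (k r t : ℕ) : ℕ := if t < k then (t + r) % k else t

theorem cyclicShift_injective (k r : ℕ) : Function.Injective (cyclicShift k r) := by
  intro a b h
  unfold cyclicShift at h
  split_ifs at h with ha hb hb
  · have h1 : a + r ≡ b + r [MOD k] := h
    have h2 := Nat.ModEq.add_right_cancel' r h1
    rwa [Nat.ModEq, Nat.mod_eq_of_lt ha, Nat.mod_eq_of_lt hb] at h2
  · exact absurd (Nat.mod_lt _ (by omega)) (h ▸ hb)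
  · exact absurd (Nat.mod_lt _ (by omega)) (h ▸ ha)
  · exact h

theorem sum_range_cyclicShift_of_le {k r t : ℕ} (h : t + r ≤ k) (f : ℕ → ℝ) :
    ∑ i ∈ Finset.range t, f (cyclicShift k r i) =
      ∑ i ∈ Finset.range (r + t), f i - ∑ i ∈ Finset.range r, f i := by
  rw [Finset.sum_range_add, add_sub_cancel_left]
  refine Finset.sum_congr rfl fun i hi => ?_
  rw [Finset.mem_range] at hi
  rw [cyclicShift, if_pos (by omega), Nat.mod_eq_of_lt (by omega), add_comm]

theorem sum_range_cyclicShift_add {k r s : ℕ} (hr : r ≤ k) (hs : s ≤ r) (f : ℕ → ℝ) :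
    ∑ i ∈ Finset.range (k - r + s), f (cyclicShift k r i) =
      ∑ i ∈ Finset.range k, f i - ∑ i ∈ Finset.range r, f i + ∑ i ∈ Finset.range s, f i := by
  rw [Finset.sum_range_add, sum_range_cyclicShift_of_le (by omega), Nat.add_sub_cancel' hr]
  congr 1
  refine Finset.sum_congr rfl fun i hi => ?_
  rw [Finset.mem_range] at hi
  have h1 : k - r + i + r = i + k := by omega
  rw [cyclicShift, if_pos (by omega), h1, Nat.add_mod_right, Nat.mod_eq_of_lt (by omega)]

theorem blockMean_cyclicShift {k r : ℕ} (hr : r ≤ k) (b : ℕ → ℝ) :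
    blockMean k (fun t => b (cyclicShift k r t)) = blockMean k b := by
  have h := sum_range_cyclicShift_add hr le_rfl b
  rw [Nat.sub_add_cancel hr, sub_add_cancel] at h
  rw [blockMean, h, blockMean]

/-- The bridge started at `r` says that the centred walk at `r'` is at least its value at `r`; the
one started at `r'` wraps around, as the walk returns to zero at `k`, and says the opposite. -/
theorem sum_Ico_eq_of_isBridge_cyclicShift {k r r' : ℕ} (hr : r < r') (hr' : r' < k)
    {b : ℕ → ℝ} (h : IsBridge k fun t => b (cyclicShift k r t))
    (h' : IsBridge k fun t => b (cyclicShift k r' t)) :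
    ∑ i ∈ Finset.range r', (b i - blockMean k b) =
      ∑ i ∈ Finset.range r, (b i - blockMean k b) := by
  have h1 := h (r' - r) (by omega)
  have h2 := h' (k - r' + r) (by omega)
  rw [blockMean_cyclicShift (by omega),
    sum_range_cyclicShift_of_le (by omega) fun i => b i - blockMean k b,
    Nat.add_sub_cancel' hr.le] at h1
  rw [blockMean_cyclicShift (by omega),
    sum_range_cyclicShift_add hr'.le hr.le fun i => b i - blockMean k b] at h2
  have h3 : ∑ i ∈ Finset.range k, (b i - blockMean k b) = 0 := by
    have hk : (k : ℝ) ≠ 0 := Nat.cast_ne_zero.2 (by omega)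
    rw [Finset.sum_sub_distrib, Finset.sum_const, Finset.card_range, nsmul_eq_mul, blockMean,
      mul_div_cancel₀ _ hk, sub_self]
  linarith

theorem ae_sum_range_sub_blockMean_ne {k r r' : ℕ} (hr : r < r') (hr' : r' < k) :
    ∀ᵐ b ∂gaussianSequence, ∑ i ∈ Finset.range r', (b i - blockMean k b) ≠
      ∑ i ∈ Finset.range r, (b i - blockMean k b) := by
  have hk : (0 : ℝ) < k := Nat.cast_pos.2 (by omega)
  have hlt : ((r' : ℝ) - r) / k < 1 := by
    rw [div_lt_one hk]
    have : (r' : ℝ) < k := Nat.cast_lt.2 hr'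
    have : (0 : ℝ) ≤ r := Nat.cast_nonneg r
    linarith
  -- The difference of the two partial sums is this linear form; its coefficient at `r` is `1 - (r'
  -- - r)/k > 0`, so the form is nondegenerate.
  have h := ae_sum_mul_ne_zero (s := Finset.range k)
    (a := fun i => (if r ≤ i ∧ i < r' then 1 else 0) - ((r' : ℝ) - r) / k) (i := r)
    (Finset.mem_range.2 (hr.trans hr')) (by simp [hr]; linarith)
  filter_upwards [h] with b hb heq
  apply hb
  simp only [sub_mul, ite_mul, one_mul, zero_mul]
  rw [Finset.sum_sub_distrib, ← Finset.sum_filter, ← Finset.mul_sum]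
  have h1 : (Finset.range k).filter (fun i => r ≤ i ∧ i < r') = Finset.Ico r r' := by
    ext i
    simp
    omega
  rw [h1, Finset.sum_Ico_eq_sub _ hr.le]
  simp only [Finset.sum_sub_distrib, Finset.sum_const, Finset.card_range, nsmul_eq_mul,
    blockMean] at heq
  rw [div_mul_eq_mul_div, mul_div_assoc]
  linarith

/-- The `k` cyclic shifts preserve both the law and the mean, and almost surely at most one of them
is a bridge, so their weights add up to at most `meanWeight`. -/
theorem mul_lintegral_bridgeWeight_le {k : ℕ} (hk : 0 < k) :
    (k : ℝ≥0∞) * ∫⁻ b, bridgeWeight k b ∂gaussianSequence ≤ 2 := by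
  classical
  have hmeas : ∀ r, Measurable fun b : ℕ → ℝ => bridgeWeight k fun t => b (cyclicShift k r t) :=
    fun r => (measurable_bridgeWeight k).comp (by fun_prop)
  calc (k : ℝ≥0∞) * ∫⁻ b, bridgeWeight k b ∂gaussianSequence
      = ∑ r ∈ Finset.range k,
          ∫⁻ b, bridgeWeight k (fun t => b (cyclicShift k r t)) ∂gaussianSequence := by
        rw [Finset.sum_congr rfl fun r _ => lintegral_gaussianSequence_comp
          (cyclicShift_injective k r) (measurable_bridgeWeight k)]
        simp
    _ = ∫⁻ b, ∑ r ∈ Finset.range k, bridgeWeight k (fun t => b (cyclicShift k r t))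
          ∂gaussianSequence := (lintegral_finsetSum _ fun r _ => hmeas r).symm
    _ ≤ ∫⁻ b, meanWeight k b ∂gaussianSequence := by
        refine lintegral_mono_ae ?_
        have hae : ∀ᵐ b ∂gaussianSequence, ∀ r r' : ℕ, r < r' → r' < k →
            ∑ i ∈ Finset.range r', (b i - blockMean k b) ≠
              ∑ i ∈ Finset.range r, (b i - blockMean k b) := by
          simp only [ae_all_iff]
          exact fun r r' hr hr' => ae_sum_range_sub_blockMean_ne hr hr'
        filter_upwards [hae] with b hb
        by_cases h : ∃ r ∈ Finset.range k, IsBridge k fun t => b (cyclicShift k r t)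
        · obtain ⟨r, hr, hbr⟩ := h
          have hr' := Finset.mem_range.1 hr
          rw [Finset.sum_eq_single_of_mem r hr, bridgeWeight, if_pos hbr, meanWeight,
            blockMean_cyclicShift hr'.le, meanWeight]
          intro s hs hne
          have hs' := Finset.mem_range.1 hs
          rw [bridgeWeight, if_neg]
          intro hbs
          rcases lt_or_gt_of_ne hne with hlt | hlt
          · exact hb _ _ hlt hr' (sum_Ico_eq_of_isBridge_cyclicShift hlt hr' hbs hbr)
          · exact hb _ _ hlt hs' (sum_Ico_eq_of_isBridge_cyclicShift hlt hs' hbr hbs)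
        · push Not at h
          rw [Finset.sum_eq_zero fun r hr => by rw [bridgeWeight, if_neg (h r hr)]]
          exact zero_le
    _ = 2 := lintegral_meanWeight hk

/-! ### Independence and the recursion for the exponential moment. -/

theorem fitWeight_congr {n : ℕ} {g h : ℕ → ℝ} (hgh : ∀ i < n, g i = h i) :
    fitWeight n g = fitWeight n h := by
  rw [fitWeight, fitWeight, isotonicFit_congr hgh]

theorem bridgeWeight_congr {k : ℕ} {g h : ℕ → ℝ} (hgh : ∀ i < k, g i = h i) :
    bridgeWeight k g = bridgeWeight k h := by
  have hmean : blockMean k g = blockMean k h := by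
    rw [blockMean, blockMean, Finset.sum_congr rfl fun i hi => hgh i (Finset.mem_range.1 hi)]
  have hbridge : IsBridge k g ↔ IsBridge k h := by
    unfold IsBridge
    rw [hmean]
    refine forall₂_congr fun t ht => ?_
    rw [Finset.sum_congr rfl fun i hi => by
      rw [hgh i ((Finset.mem_range.1 hi).trans_le ht)]]
  by_cases h' : IsBridge k h
  · rw [bridgeWeight, bridgeWeight, if_pos h', if_pos (hbridge.2 h'), meanWeight, meanWeight, hmean]
  · rw [bridgeWeight, bridgeWeight, if_neg h', if_neg (mt hbridge.1 h')]

/-- Functions of disjoint segments of a Gaussian sequence are independent. -/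
theorem lintegral_mul_gaussianSequence {k r : ℕ} {φ ψ : (ℕ → ℝ) → ℝ≥0∞} (hφ : Measurable φ)
    (hψ : Measurable ψ) (hφk : ∀ g h, (∀ i < k, g i = h i) → φ g = φ h)
    (hψr : ∀ g h, (∀ i < r, g i = h i) → ψ g = ψ h) :
    ∫⁻ g, φ g * ψ (fun s => g (k + s)) ∂gaussianSequence =
      (∫⁻ g, φ g ∂gaussianSequence) * ∫⁻ g, ψ g ∂gaussianSequence := by
  classical
  have hdisj : Disjoint (Finset.range k) (Finset.Ico k (k + r)) := by
    rw [Finset.disjoint_left]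
    intro i h1 h2
    rw [Finset.mem_range] at h1
    rw [Finset.mem_Ico] at h2
    omega
  have hind := iIndepFun_gaussianSequence.indepFun_finset _ _ hdisj fun i => by fun_prop
  -- Padding by zero is harmless in both cases, because `φ` and `ψ` only see their first `k` and `r`
  -- coordinates.
  set Φ : ((Finset.range k) → ℝ) → ℝ≥0∞ := fun v =>
    φ fun i => if h : i ∈ Finset.range k then v ⟨i, h⟩ else 0
  set Ψ : ((Finset.Ico k (k + r)) → ℝ) → ℝ≥0∞ := fun v =>
    ψ fun i => if h : k + i ∈ Finset.Ico k (k + r) then v ⟨k + i, h⟩ else 0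
  have hΦ : Measurable Φ := hφ.comp <| measurable_pi_lambda _ fun i => by
    by_cases h : i ∈ Finset.range k
    · simp only [h, dite_true]; fun_prop
    · simp only [h, dite_false]; fun_prop
  have hΨ : Measurable Ψ := hψ.comp <| measurable_pi_lambda _ fun i => by
    by_cases h : k + i ∈ Finset.Ico k (k + r)
    · simp only [h, dite_true]; fun_prop
    · simp only [h, dite_false]; fun_prop
  have hmul := lintegral_mul_eq_lintegral_mul_lintegral_of_indepFun
    (hΦ.comp (by fun_prop)) (hΨ.comp (by fun_prop)) (hind.comp hΦ hΨ)
  have h1 : ∀ g : ℕ → ℝ, Φ (fun i : Finset.range k => g i) = φ g := fun g =>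
    hφk _ _ fun i hi => by simp [hi]
  have h2 : ∀ g : ℕ → ℝ, Ψ (fun i : Finset.Ico k (k + r) => g i) = ψ fun s => g (k + s) := fun g =>
    hψr _ _ fun i hi => by simp [hi]
  simp only [Pi.mul_apply, Function.comp_apply, h1, h2] at hmul
  rw [hmul, lintegral_gaussianSequence_comp (add_right_injective k) hψ]

/-- The exponential moment of the squared norm of the isotonic fit of a Gaussian vector. -/
noncomputable def fitMoment (n : ℕ) : ℝ≥0∞ := ∫⁻ g, fitWeight n g ∂gaussianSequence

theorem mul_fitMoment_le (n : ℕ) :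
    (n : ℝ≥0∞) * fitMoment n ≤ 2 * ∑ r ∈ Finset.range n, fitMoment r := by
  have hcomp : ∀ r k j, Measurable fun g : ℕ → ℝ =>
      blockWeight r k j fun s => g (blockToFront j k s) := fun r k j =>
    (measurable_blockWeight r k j).comp (by fun_prop)
  calc (n : ℝ≥0∞) * fitMoment n = ∫⁻ g, (n : ℝ≥0∞) * fitWeight n g ∂gaussianSequence :=
        (lintegral_const_mul _ (measurable_fitWeight n)).symm
    _ ≤ ∫⁻ g, ∑ r ∈ Finset.range n, ∑ j ∈ Finset.range (r + 1), ((n - r : ℕ) : ℝ≥0∞) *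
          blockWeight r (n - r) j (fun s => g (blockToFront j (n - r) s)) ∂gaussianSequence :=
        lintegral_mono (nsmul_fitWeight_le n)
    _ = ∑ r ∈ Finset.range n, ((n - r : ℕ) : ℝ≥0∞) *
          ∫⁻ b, ∑ j ∈ Finset.range (r + 1), blockWeight r (n - r) j b ∂gaussianSequence := by
        rw [lintegral_finsetSum _ fun r _ => Finset.measurable_sum _ fun j _ =>
          (hcomp _ _ _).const_mul _]
        refine Finset.sum_congr rfl fun r _ => ?_
        rw [lintegral_finsetSum _ fun j _ => (hcomp _ _ _).const_mul _,
          lintegral_finsetSum _ fun j _ => measurable_blockWeight _ _ _, Finset.mul_sum]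
        refine Finset.sum_congr rfl fun j _ => ?_
        rw [lintegral_const_mul _ (hcomp _ _ _),
          lintegral_gaussianSequence_comp (blockToFront_injective _ _) (measurable_blockWeight _ _ _)]
    _ ≤ ∑ r ∈ Finset.range n, 2 * fitMoment r := by
        refine Finset.sum_le_sum fun r hr => ?_
        rw [Finset.mem_range] at hr
        calc ((n - r : ℕ) : ℝ≥0∞) *
              ∫⁻ b, ∑ j ∈ Finset.range (r + 1), blockWeight r (n - r) j b ∂gaussianSequence
            ≤ ((n - r : ℕ) : ℝ≥0∞) * ∫⁻ b, bridgeWeight (n - r) b *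
                fitWeight r (fun s => b (n - r + s)) ∂gaussianSequence := by
              gcongr with b
              exact sum_blockWeight_le _ _ _
          _ = (((n - r : ℕ) : ℝ≥0∞) * ∫⁻ b, bridgeWeight (n - r) b ∂gaussianSequence) *
                fitMoment r := by
              rw [lintegral_mul_gaussianSequence (measurable_bridgeWeight _)
                (measurable_fitWeight r) (fun _ _ => bridgeWeight_congr)
                (fun _ _ => fitWeight_congr), mul_assoc, fitMoment]
          _ ≤ 2 * fitMoment r := by
              gcongr
              exact mul_lintegral_bridgeWeight_le (by omega)
    _ = 2 * ∑ r ∈ Finset.range n, fitMoment r := (Finset.mul_sum _ _ _).symm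

/-- The sequence `n + 1` starts at the right value and solves the recursion with equality. -/
theorem fitMoment_le (n : ℕ) : fitMoment n ≤ n + 1 := by
  induction n using Nat.strong_induction_on with
  | _ n ih =>
    rcases Nat.eq_zero_or_pos n with rfl | hn
    · simp [fitMoment, fitWeight]
    · have hsum : (2 : ℝ≥0∞) * ∑ r ∈ Finset.range n, ((r : ℝ≥0∞) + 1) = n * (n + 1) := by
        have h : ∀ m : ℕ, 2 * ∑ r ∈ Finset.range m, (r + 1) = m * (m + 1) := fun m => by
          induction m with
          | zero => simp
          | succ m ih => rw [Finset.sum_range_succ, mul_add, ih]; ring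
        exact_mod_cast congrArg (Nat.cast : ℕ → ℝ≥0∞) (h n)
      have h : (n : ℝ≥0∞) * fitMoment n ≤ n * (n + 1) := by
        refine (mul_fitMoment_le n).trans ?_
        rw [← hsum]
        gcongr with r hr
        exact ih r (Finset.mem_range.1 hr)
      exact (ENNReal.mul_le_mul_iff_right (by simpa using hn.ne') (by simp)).1 h

/-! ### From convex sequences to pairs of isotonic fits. -/

/-- A convex sequence is first nonincreasing and then nondecreasing. -/
theorem exists_antitone_monotone_of_mem_convexSeqCone {n : ℕ} (hn : 0 < n) {x : Fin n → ℝ}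
    (hx : StrictMono x) {u : EuclideanSpace ℝ (Fin n)} (hu : u ∈ convexSeqCone x) {v : ℕ → ℝ}
    (hv : ∀ i : Fin n, v i = u i) :
    ∃ m < n, (∀ i < m, v (i + 1) ≤ v i) ∧ ∀ i, m ≤ i → i + 1 < n → v i ≤ v (i + 1) := by
  classical
  have hstep : ∀ i, i + 2 < n → v i ≤ v (i + 1) → v (i + 1) ≤ v (i + 2) := by
    intro i hi h
    have h1 := hu i hi
    rw [← hv, ← hv, ← hv] at h1
    have hx1 : x ⟨i, by omega⟩ < x ⟨i + 1, by omega⟩ := hx (by simp)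
    have hx2 : x ⟨i + 1, by omega⟩ < x ⟨i + 2, hi⟩ := hx (by simp)
    have h2 := (div_nonneg (sub_nonneg.2 h) (sub_pos.2 hx1).le).trans h1
    rw [le_div_iff₀ (sub_pos.2 hx2), zero_mul] at h2
    exact sub_nonneg.1 h2
  -- The turning point is the first index with a nonnegative step, or `n - 1` if every step is
  -- negative.
  have hm : ∃ m, n ≤ m + 1 ∨ v m ≤ v (m + 1) := ⟨n, Or.inl (by omega)⟩
  have hm1 := Nat.find_spec hm
  have hm2 : ∀ i < Nat.find hm, ¬ (n ≤ i + 1 ∨ v i ≤ v (i + 1)) := fun i hi => Nat.find_min hm hi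
  have hm3 : Nat.find hm ≤ n - 1 := Nat.find_le (Or.inl (by omega))
  generalize Nat.find hm = m at *
  refine ⟨m, by omega, fun i hi => ?_, fun i hi => ?_⟩
  · have := hm2 i hi
    push Not at this
    exact this.2.le
  · induction i, hi using Nat.le_induction with
    | base =>
      intro h
      rcases hm1 with h1 | h1
      · omega
      · exact h1
    | succ i hi ih => exact fun h => hstep i h (ih (by omega))

/-- Reversal of the first `m` indices. -/
def reverseIndex (m i : ℕ) : ℕ := if i < m then m - 1 - i else i

theorem reverseIndex_injective (m : ℕ) : Function.Injective (reverseIndex m) := by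
  intro a b h
  unfold reverseIndex at h
  split_ifs at h <;> omega

theorem sum_range_reverseIndex (m : ℕ) (f : ℕ → ℝ) :
    ∑ i ∈ Finset.range m, f (reverseIndex m i) = ∑ i ∈ Finset.range m, f i := by
  rw [← Finset.sum_range_reflect f]
  exact Finset.sum_congr rfl fun i hi => by rw [reverseIndex, if_pos (Finset.mem_range.1 hi)]

/-- The two monotone pieces of the projection are competitors in separate isotonic problems; the
decreasing piece is read backwards. The index `m` depends on `g`. -/
theorem exists_norm_coneProj_convexSeqCone_sq_le {n : ℕ} (hn : 0 < n) {x : Fin n → ℝ}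
    (hx : StrictMono x) (g : ℕ → ℝ) :
    ∃ m < n, ‖coneProj (convexSeqCone x) (initialVector n g)‖ ^ 2 ≤
      ∑ i ∈ Finset.range m, isotonicFit m (fun s => g (reverseIndex m s)) i ^ 2 +
      ∑ i ∈ Finset.range (n - m), isotonicFit (n - m) (fun s => g (m + s)) i ^ 2 := by
  set p := coneProj (convexSeqCone x) (initialVector n g) with hp
  set v : ℕ → ℝ := fun i => if h : i < n then p ⟨i, h⟩ else 0 with hv
  have hvp : ∀ i : Fin n, v i = p i := fun i => by simp [hv]
  obtain ⟨m, hm, hanti, hmono⟩ := exists_antitone_monotone_of_mem_convexSeqCone hn hx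
    (coneProj_spec (convexSeqCone x) (initialVector n g)).1 hvp
  refine ⟨m, hm, ?_⟩
  have hnorm : ‖p‖ ^ 2 = ∑ i ∈ Finset.range n, (2 * (g i * v i) - v i ^ 2) := by
    rw [hp, norm_coneProj_sq, ← hp, EuclideanSpace.real_norm_sq_eq, PiLp.inner_apply,
      Finset.sum_range, Finset.mul_sum, ← Finset.sum_sub_distrib]
    refine Finset.sum_congr rfl fun i _ => ?_
    rw [hvp]
    simp [initialVector, mul_comm]
  obtain ⟨r, rfl⟩ := Nat.exists_eq_add_of_le hm.le
  rw [hnorm, Finset.sum_range_add, Nat.add_sub_cancel_left,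
    ← sum_range_reverseIndex m fun i => 2 * (g i * v i) - v i ^ 2]
  refine add_le_add ?_ ?_
  · refine (isIsotonicFit_isotonicFit m fun s => g (reverseIndex m s)).sum_le_sum_sq
      (v := fun s => v (reverseIndex m s)) fun i hi => ?_
    have h1 : reverseIndex m i = reverseIndex m (i + 1) + 1 := by
      unfold reverseIndex
      rw [if_pos (by omega), if_pos hi]
      omega
    have h2 : reverseIndex m (i + 1) < m := by
      unfold reverseIndex
      rw [if_pos hi]
      omega
    rw [h1]
    exact hanti _ h2
  · exact (isIsotonicFit_isotonicFit r fun s => g (m + s)).sum_le_sum_sq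
      (v := fun s => v (m + s)) fun i hi => hmono _ (by omega) (by omega)

theorem lintegral_exp_norm_coneProj_convexSeqCone_le {n : ℕ} (hn : 0 < n) {x : Fin n → ℝ}
    (hx : StrictMono x) :
    ∫⁻ y, ENNReal.ofReal (Real.exp (3 / 8 * ‖coneProj (convexSeqCone x) y‖ ^ 2))
      ∂stdGaussian (EuclideanSpace ℝ (Fin n)) ≤ ENNReal.ofReal ((Real.exp 1 * n) ^ 3) := by
  have hcont := continuous_coneProj (convexSeqCone x)
  have hrev : ∀ m, Measurable fun g : ℕ → ℝ => fitWeight m fun s => g (reverseIndex m s) :=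
    fun m => (measurable_fitWeight m).comp (by fun_prop)
  have hshift : ∀ m, Measurable fun g : ℕ → ℝ => fitWeight (n - m) fun s => g (m + s) :=
    fun m => (measurable_fitWeight _).comp (by fun_prop)
  rw [← map_gaussianSequence_initialVector, lintegral_map
    (Measurable.ennreal_ofReal (Continuous.measurable (by fun_prop)))
    (measurable_initialVector n)]
  calc _ ≤ ∫⁻ g, ∑ m ∈ Finset.range n, fitWeight m (fun s => g (reverseIndex m s)) *
        fitWeight (n - m) (fun s => g (m + s)) ∂gaussianSequence := by
        -- The random turning point is removed by bounding its term by the sum over all `m`.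
        refine lintegral_mono fun g => ?_
        obtain ⟨m, hm, hle⟩ := exists_norm_coneProj_convexSeqCone_sq_le hn hx g
        refine le_trans ?_ (Finset.single_le_sum
          (f := fun m => fitWeight m (fun s => g (reverseIndex m s)) *
            fitWeight (n - m) (fun s => g (m + s))) (fun _ _ => zero_le) (Finset.mem_range.2 hm))
        dsimp only
        rw [fitWeight, fitWeight, ← ENNReal.ofReal_mul (Real.exp_pos _).le, ← Real.exp_add,
          ← mul_add]
        exact ENNReal.ofReal_le_ofReal (Real.exp_le_exp.2 (by linarith))
    _ = ∑ m ∈ Finset.range n, fitMoment m * fitMoment (n - m) := by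
        rw [lintegral_finsetSum _ fun m _ => by exact (hrev m).mul (hshift m)]
        refine Finset.sum_congr rfl fun m _ => ?_
        rw [lintegral_mul_gaussianSequence (k := m) (hrev m) (measurable_fitWeight (n - m)) ?_
          (fun _ _ => fitWeight_congr),
          lintegral_gaussianSequence_comp (reverseIndex_injective m) (measurable_fitWeight m)]
        · rfl
        · intro g h hgh
          refine fitWeight_congr fun i hi => hgh _ ?_
          unfold reverseIndex
          split_ifs
          omega
    _ ≤ ∑ m ∈ Finset.range n, ((n * (n + 1) : ℕ) : ℝ≥0∞) := by
        refine Finset.sum_le_sum fun m hm => ?_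
        rw [Finset.mem_range] at hm
        rw [Nat.cast_mul]
        refine mul_le_mul' ((fitMoment_le m).trans ?_) ((fitMoment_le _).trans ?_)
        · exact_mod_cast hm
        · exact_mod_cast (by omega : n - m + 1 ≤ n + 1)
    _ = ENNReal.ofReal (n * (n * (n + 1))) := by
        rw [Finset.sum_const, Finset.card_range, nsmul_eq_mul, ← Nat.cast_mul,
          ← ENNReal.ofReal_natCast]
        push_cast
        rfl
    _ ≤ _ := by
        refine ENNReal.ofReal_le_ofReal ?_
        -- There is ample room: `n²(n + 1) ≤ 2n³ ≤ (2n)³ ≤ (e n)³`.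
        have h1 : (1 : ℝ) ≤ n := Nat.one_le_cast.2 hn
        have h2 : (2 : ℝ) ≤ Real.exp 1 := by
          have := Real.add_one_le_exp (1 : ℝ)
          linarith
        have h3 : (2 * (n : ℝ)) ^ 3 ≤ (Real.exp 1 * n) ^ 3 := by gcongr
        refine le_trans ?_ h3
        nlinarith [sq_nonneg (n : ℝ), mul_nonneg (sq_nonneg (n : ℝ)) (sub_nonneg.2 h1)]

/-! ### Jensen's inequality and conclusion. -/

/-- Jensen's inequality for the exponential, from a bound on the exponential moment. -/
theorem integral_le_log_of_lintegral_exp_le {α : Type*} [MeasurableSpace α] {μ : Measure α}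
    [IsProbabilityMeasure μ] {f : α → ℝ} (hf : Measurable f) (hf0 : ∀ a, 0 ≤ f a) {M : ℝ}
    (hM : 0 < M) (h : ∫⁻ a, ENNReal.ofReal (Real.exp (f a)) ∂μ ≤ ENNReal.ofReal M) :
    Integrable f μ ∧ ∫ a, f a ∂μ ≤ Real.log M := by
  have hexp : Integrable (fun a => Real.exp (f a)) μ := by
    refine ⟨by fun_prop, ?_⟩
    rw [hasFiniteIntegral_iff_ofReal (Filter.Eventually.of_forall fun a => (Real.exp_pos _).le)]
    exact h.trans_lt ENNReal.ofReal_lt_top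
  have hint : Integrable f μ := hexp.mono' (by fun_prop) (Filter.Eventually.of_forall fun a => by
    rw [Real.norm_of_nonneg (hf0 a)]
    linarith [Real.add_one_le_exp (f a)])
  refine ⟨hint, ?_⟩
  have hle : ∫ a, Real.exp (f a) ∂μ ≤ M := by
    rw [← ofReal_integral_eq_lintegral_ofReal hexp
      (Filter.Eventually.of_forall fun a => (Real.exp_pos _).le)] at h
    exact (ENNReal.ofReal_le_ofReal_iff hM.le).1 h
  -- This is the tangent-line bound for `exp` at `log M`, integrated.
  calc ∫ a, f a ∂μ ≤ ∫ a, (Real.exp (f a) / M + (Real.log M - 1)) ∂μ := by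
        refine integral_mono hint ((hexp.div_const M).add (integrable_const _)) fun a => ?_
        have h1 := Real.add_one_le_exp (f a - Real.log M)
        rw [Real.exp_sub, Real.exp_log hM] at h1
        dsimp only
        linarith
    _ = (∫ a, Real.exp (f a) ∂μ) / M + (Real.log M - 1) := by
        rw [integral_add (hexp.div_const M) (integrable_const _), integral_div]
        simp
    _ ≤ 1 + (Real.log M - 1) := by
        gcongr
        exact (div_le_one hM).2 hle
    _ = Real.log M := by ring

theorem mainTheorem4 (n : ℕ) (hn : 3 ≤ n) (x : Fin n → ℝ) (hx : StrictMono x)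
    {Ω : Type*} [MeasurableSpace Ω] (P : Measure Ω) (g : Ω → EuclideanSpace ℝ (Fin n))
    (hg : HasLaw g (stdGaussian (EuclideanSpace ℝ (Fin n))) P) :
    Integrable (fun ω => ‖coneProj (convexSeqCone x) (g ω)‖ ^ 2) P ∧
      statDim (convexSeqCone x) = ∫ ω, ‖coneProj (convexSeqCone x) (g ω)‖ ^ 2 ∂P ∧
      statDim (convexSeqCone x) ≤ 8 * Real.log (Real.exp 1 * n) := by
  have hn0 : (0 : ℝ) < n := Nat.cast_pos.2 (by omega)
  have hmeas : Measurable fun y => ‖coneProj (convexSeqCone x) y‖ ^ 2 := by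
    have := continuous_coneProj (convexSeqCone x)
    exact Continuous.measurable (by fun_prop)
  obtain ⟨hint, hle⟩ := integral_le_log_of_lintegral_exp_le (hmeas.const_mul (3 / 8))
    (fun y => by positivity) (by positivity)
    (lintegral_exp_norm_coneProj_convexSeqCone_le (by omega) hx)
  have hint' : Integrable (fun y => ‖coneProj (convexSeqCone x) y‖ ^ 2)
      (stdGaussian (EuclideanSpace ℝ (Fin n))) := by
    simpa [← mul_assoc] using hint.const_mul (8 / 3)
  -- The constant `8` is the exponent `3` of `(e n)³` divided by the rate `3/8`.
  rw [integral_const_mul, Real.log_pow] at hle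
  refine ⟨?_, ?_, ?_⟩
  · rw [← hg.map_eq] at hint'
    exact hint'.comp_aemeasurable hg.aemeasurable
  · exact (hg.integral_comp hmeas.aestronglyMeasurable).symm
  · rw [statDim]
    push_cast at hle
    linarith
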